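/- Let $d\ge 2$ and let $\mathbb T_d=(\mathbb V_d,\mathbb E_d)$ be the regular $d$-ary tree: $\mathbb V_d=\bigcup_{n\ge 0}\{1,\dots,d\}^n$ is the set of finite words over $d$ letters, the root $o$ is the empty word, and the edges are $\langle x,x\cdot a\rangle$ for $x\in\mathbb V_d$ and $a\in\{1,\dots,d\}$, where $x\cdot a$ is $x$ followed by $a$. Let $P$ be the product of the Lebesgue measures on $[0,1]^{\mathbb E_d}$, so that under $P$ the clocks $U=(U_e)_{e\in\mathbb E_d}$ are i.i.d. uniform on $[0,1]$. In the constrained-degree percolation model on $\mathbb T_d$ with degree bound $2$ at every vertex, the configurations $\omega_t=\omega_t(U)\in\{0,1\}^{\mathbb E_d}$, $t\in[0,1]$, are determined by the rule that $\omega_{t,e}=1$ (the edge $e=\langle u_1,u_2\rangle$ is open at time $t$) if and only if $U_e<t$ and $$\#\{v\in\mathbb V_d\setminus\{u_{3-i}\}:\ \langle u_i,v\rangle\in\mathbb E_d,\ \omega_{U_e,\langle u_i,v\rangle}=1\}<2,\qquad i=1,2.$$ For $P$-almost every $U$ there is exactly one family $(\omega_t)_{t\in[0,1]}$ that satisfies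 this rule for all $t\in[0,1]$ and all edges $e$, so the model is well defined. There is no percolation at any time: $$\theta(t)=P\{\text{infinitely many vertices are connected to } o \text{ by paths of edges open at time } t\}=0\quad\text{for all } t\in[0,1].$$ -/

import Mathlib

open MeasureTheory

namespace ConstrainedDegree

/-- The law of the clocks: i.i.d. uniform times on `[0,1]`, one for each edge of `G`, that is, the
product of the Lebesgue measures on the cylinder sigma-algebra of `[0,1]^E`. -/
noncomputable def clockMeasure {V : Type*} (G : SimpleGraph V) :
    Measure (G.edgeSet → unitInterval) :=
  Measure.infinitePi fun _ : G.edgeSet => (volume : Measure unitInterval)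

/-- `ω t` (the graph of the edges that are open at time `t`) is an evolution of the
constrained-degree percolation model on `G` with degree restrictions `k` and clocks `U`:
the edge `e = s(x, y)` of `G` is open at time `t` iff its clock has rung before `t` and, at the time
`U e`, each of its two end-vertices had fewer than `k` open edges apart from `e`. -/
def IsTemporalConfiguration {V : Type*} (G : SimpleGraph V) (k : V → ℕ)
    (U : G.edgeSet → unitInterval) (ω : unitInterval → SimpleGraph V) : Prop :=
  ∀ (t : unitInterval) (x y : V), (ω t).Adj x y ↔
    ∃ h : s(x, y) ∈ G.edgeSet, U ⟨s(x, y), h⟩ < t ∧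
      ((ω (U ⟨s(x, y), h⟩)).neighborSet x \ {y}).encard < k x ∧
      ((ω (U ⟨s(x, y), h⟩)).neighborSet y \ {x}).encard < k y

open Classical in
/-- The temporal configuration: the unique evolution driven by the clocks `U`. Where existence or
uniqueness fails, all edges are declared closed. -/
noncomputable def temporalConfiguration {V : Type*} (G : SimpleGraph V) (k : V → ℕ)
    (U : G.edgeSet → unitInterval) : unitInterval → SimpleGraph V :=
  if h : ∃! ω, IsTemporalConfiguration G k U ω then h.choose else fun _ => ⊥

/-- The event that, at time `t`, infinitely many vertices are connected to `o` by open paths. -/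
def percolationEvent {V : Type*} (G : SimpleGraph V) (k : V → ℕ) (o : V) (t : unitInterval) :
    Set (G.edgeSet → unitInterval) :=
  {U | {v : V | (temporalConfiguration G k U t).Reachable o v}.Infinite}

/-- The percolation function: the probability that `o` percolates at time `t`. -/
noncomputable def theta {V : Type*} (G : SimpleGraph V) (k : V → ℕ) (o : V) (t : unitInterval) :
    ENNReal :=
  clockMeasure G (percolationEvent G k o t)

/-- The regular `d`-ary tree: its vertices are the finite words over an alphabet with `d` letters,
its edges join each word `x` to the words `x · a`, and its root is the empty word. -/
def regularTree (d : ℕ) : SimpleGraph (List (Fin d)) where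
  Adj x y := (∃ a : Fin d, y = x ++ [a]) ∨ (∃ a : Fin d, x = y ++ [a])
  symm := ⟨fun _ _ h => h.symm⟩
  loopless := ⟨fun x h => by rcases h with ⟨a, h⟩ | ⟨a, h⟩ <;> simp at h⟩

end ConstrainedDegree

/-! Time can be eliminated: an evolution is determined by the graph `H` of edges that satisfy the
degree rule at their own ring, and these graphs are the fixed points of `step`. An edge depends only
on adjacent edges with earlier clocks. Almost surely there is no infinite chain of adjacent edges
with decreasing clocks (`ae_wellFounded_lt`), which gives existence and uniqueness of the fixed
point.

With distinct clocks every vertex has at most two open edges. A non-root vertex of the root's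
cluster spends one on its parent, so the cluster is a bundle of paths that branch only at the root,
and it has at most `d + 1` ends (`card_le_of_isRootLeaf`). On the other hand, every vertex `v` that
can be reached has a uniformly positive chance of being an end. Indeed `reachEvent v` ignores the
clocks in the three generations below `v`, so it is independent of the event that these clocks make
`v` a dead end, and that event has probability at least `2⁻¹ ^ N` with `N = d + d² + d³`. Hence `2⁻¹
^ N` times the sum over `v` of the probabilities of `reachEvent v` is at most `d + 1`. The sum is
finite, and Borel–Cantelli leaves only finitely many reachable vertices. -/

namespace ConstrainedDegree

open Filter

/-! ### Evolutions as fixed points, for deterministic clocks on a general graph. -/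

section Deterministic

variable {V : Type*} {G : SimpleGraph V} {k : V → ℕ}

open Classical in
/-- The clocks extended to all pairs of vertices, with value `1` off the graph. -/
noncomputable def extendClock (U : G.edgeSet → unitInterval) (e : Sym2 V) : unitInterval :=
  if h : e ∈ G.edgeSet then U ⟨e, h⟩ else 1

lemma extendClock_of_mem (U : G.edgeSet → unitInterval) {e : Sym2 V} (h : e ∈ G.edgeSet) :
    extendClock U e = U ⟨e, h⟩ := dif_pos h

/-- The neighbours of `x` in `H` along edges whose clock rings before `s`. -/
def earlierNeighbors (c : Sym2 V → unitInterval) (H : SimpleGraph V) (x : V) (s : unitInterval) :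
    Set V :=
  {z | H.Adj x z ∧ c s(x, z) < s}

/-- The edges of `H` whose clock rings before `t`. -/
def openBefore (c : Sym2 V → unitInterval) (H : SimpleGraph V) (t : unitInterval) :
    SimpleGraph V where
  Adj x y := H.Adj x y ∧ c s(x, y) < t
  symm := ⟨fun x y h => ⟨h.1.symm, by rw [Sym2.eq_swap]; exact h.2⟩⟩
  loopless := ⟨fun x h => h.1.ne rfl⟩

/-- The edges of `G` that satisfy the degree rule, when the edges that open are those of `H`. -/
def step (G : SimpleGraph V) (k : V → ℕ) (c : Sym2 V → unitInterval) (H : SimpleGraph V) :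
    SimpleGraph V where
  Adj x y := G.Adj x y ∧ (earlierNeighbors c H x (c s(x, y))).encard < k x ∧
    (earlierNeighbors c H y (c s(x, y))).encard < k y
  symm := ⟨fun x y h => ⟨h.1.symm, by rw [Sym2.eq_swap]; exact ⟨h.2.2, h.2.1⟩⟩⟩
  loopless := ⟨fun x h => h.1.ne rfl⟩

lemma step_le (c : Sym2 V → unitInterval) (H : SimpleGraph V) : step G k c H ≤ G :=
  fun _ _ h => h.1

lemma le_of_step_eq {c : Sym2 V → unitInterval} {H : SimpleGraph V} (hH : step G k c H = H) :
    H ≤ G := hH ▸ step_le c H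

lemma adj_iff_of_step_eq {c : Sym2 V → unitInterval} {H : SimpleGraph V}
    (hH : step G k c H = H) (x y : V) :
    H.Adj x y ↔ G.Adj x y ∧ (earlierNeighbors c H x (c s(x, y))).encard < k x ∧
      (earlierNeighbors c H y (c s(x, y))).encard < k y := by
  conv_lhs => rw [← hH]
  rfl

/-- Removing `y` costs nothing: an edge never rings strictly before itself. -/
lemma neighborSet_openBefore_diff (c : Sym2 V → unitInterval) (H : SimpleGraph V) (x y : V) :
    (openBefore c H (c s(x, y))).neighborSet x \ {y} = earlierNeighbors c H x (c s(x, y)) := by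
  ext z
  simp only [openBefore, earlierNeighbors, SimpleGraph.neighborSet, Set.mem_sdiff,
    Set.mem_ofPred_eq, Set.mem_singleton_iff, and_iff_left_iff_imp]
  rintro ⟨-, h⟩ rfl
  exact lt_irrefl _ h

lemma isTemporalConfiguration_iff_extendClock (U : G.edgeSet → unitInterval)
    (ω : unitInterval → SimpleGraph V) :
    IsTemporalConfiguration G k U ω ↔ ∀ t x y, (ω t).Adj x y ↔
      (G.Adj x y ∧ ((ω (extendClock U s(x, y))).neighborSet x \ {y}).encard < k x ∧
        ((ω (extendClock U s(x, y))).neighborSet y \ {x}).encard < k y) ∧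
      extendClock U s(x, y) < t := by
  unfold IsTemporalConfiguration
  refine forall_congr' fun t => forall_congr' fun x => forall_congr' fun y => ?_
  refine iff_congr Iff.rfl ⟨?_, ?_⟩
  · rintro ⟨h, h1, h2⟩
    rw [extendClock_of_mem U h]
    exact ⟨⟨h, h2⟩, h1⟩
  · rintro ⟨⟨h, h2⟩, h1⟩
    rw [← SimpleGraph.mem_edgeSet] at h
    rw [extendClock_of_mem U h] at h1 h2
    exact ⟨h, h1, h2⟩

/-- The evolutions driven by `U` are given by the fixed points of `step`. -/
theorem isTemporalConfiguration_iff (U : G.edgeSet → unitInterval)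
    (ω : unitInterval → SimpleGraph V) :
    IsTemporalConfiguration G k U ω ↔
      ∃ H, step G k (extendClock U) H = H ∧ ω = openBefore (extendClock U) H := by
  rw [isTemporalConfiguration_iff_extendClock]
  set c := extendClock U
  constructor
  · intro h
    let H : SimpleGraph V :=
      { Adj x y := G.Adj x y ∧ ((ω (c s(x, y))).neighborSet x \ {y}).encard < k x ∧
          ((ω (c s(x, y))).neighborSet y \ {x}).encard < k y
        symm := ⟨fun x y h => ⟨h.1.symm, by rw [Sym2.eq_swap]; exact ⟨h.2.2, h.2.1⟩⟩⟩
        loopless := ⟨fun x h => h.1.ne rfl⟩ }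
    have hω : ω = openBefore c H := by
      funext t
      ext x y
      exact h t x y
    refine ⟨H, ?_, hω⟩
    ext x y
    have h1 : (ω (c s(x, y))).neighborSet x \ {y} = earlierNeighbors c H x (c s(x, y)) := by
      rw [hω, neighborSet_openBefore_diff]
    have h2 : (ω (c s(x, y))).neighborSet y \ {x} = earlierNeighbors c H y (c s(x, y)) := by
      rw [hω, Sym2.eq_swap, neighborSet_openBefore_diff]
    simp only [H, step, ← h1, ← h2]
  · rintro ⟨H, hH, rfl⟩ t x y
    have h2 := neighborSet_openBefore_diff c H y x
    rw [Sym2.eq_swap] at h2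
    rw [neighborSet_openBefore_diff, h2, ← adj_iff_of_step_eq hH]
    rfl

/-- The edge `e'` of `G` meets the edge `e`, and its clock rings before that of `e`. -/
def Precedes (G : SimpleGraph V) (c : Sym2 V → unitInterval) (e' e : Sym2 V) : Prop :=
  e' ∈ G.edgeSet ∧ e ∈ G.edgeSet ∧ (∃ x ∈ e, x ∈ e') ∧ c e' < c e

lemma precedes_left {c : Sym2 V → unitInterval} {x y z : V} (h : G.Adj x y) (hz : G.Adj x z)
    (hc : c s(x, z) < c s(x, y)) : Precedes G c s(x, z) s(x, y) :=
  ⟨hz, h, ⟨x, by simp, by simp⟩, hc⟩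

lemma precedes_right {c : Sym2 V → unitInterval} {x y z : V} (h : G.Adj x y) (hz : G.Adj y z)
    (hc : c s(y, z) < c s(x, y)) : Precedes G c s(y, z) s(x, y) :=
  ⟨hz, h, ⟨y, by simp, by simp⟩, hc⟩

/-- Raising clocks to the maximal value `1` keeps the order of rings well founded. -/
lemma wellFounded_precedes_of_eq_or_eq_one {c c' : Sym2 V → unitInterval}
    (hwf : WellFounded (Precedes G c)) (h : ∀ e, c' e = c e ∨ c' e = 1) :
    WellFounded (Precedes G c') := by
  have key : ∀ e, c' e ≠ 1 → Acc (Precedes G c') e := by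
    intro e
    induction e using hwf.induction with
    | _ e ih =>
      intro he
      refine Acc.intro _ fun e' h' => ?_
      have h1 : c' e' ≠ 1 := (h'.2.2.2.trans_le unitInterval.le_one').ne
      refine ih e' ⟨h'.1, h'.2.1, h'.2.2.1, ?_⟩ h1
      rw [← (h e').resolve_right h1, ← (h e).resolve_right he]
      exact h'.2.2.2
  -- An edge with clock `1` is not covered by `key`, but all its predecessors ring strictly before
  -- `1`.
  refine ⟨fun e => Acc.intro _ fun e' h' => key e' ?_⟩
  exact (h'.2.2.2.trans_le unitInterval.le_one').ne

/-- Two fixed points agree on the edges off `W`, if the clocks agree off `W` and the rule at the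
vertices of `W` does not close any edge between `W` and its complement. -/
theorem adj_iff_adj_of_attached {c c' : Sym2 V → unitInterval} {H H' : SimpleGraph V}
    (hwf : WellFounded (Precedes G c)) (hH : step G k c H = H) (hH' : step G k c' H' = H')
    {W : Set V} (hc : ∀ x y, y ∉ W → G.Adj x y → c s(x, y) = c' s(x, y))
    (hW : ∀ x ∈ W, ∀ y ∉ W, G.Adj x y → (earlierNeighbors c H x (c s(x, y))).encard < k x)
    (hW' : ∀ x ∈ W, ∀ y ∉ W, G.Adj x y →
      (earlierNeighbors c' H' x (c' s(x, y))).encard < k x)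
    {x y : V} (hy : y ∉ W) : H.Adj x y ↔ H'.Adj x y := by
  have key : ∀ e : Sym2 V, ∀ x y, e = s(x, y) → y ∉ W → (H.Adj x y ↔ H'.Adj x y) := by
    intro e
    induction e using hwf.induction with
    | _ e ih =>
      rintro x y rfl hy
      rw [adj_iff_of_step_eq hH, adj_iff_of_step_eq hH']
      refine and_congr_right fun hG => ?_
      have hcc := hc x y hy hG
      -- Every edge at `y ∉ W` has an endpoint off `W`, so the induction hypothesis covers the
      -- earlier ones. The same works at `x` unless `x ∈ W`, where the rule holds on both sides by
      -- assumption.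
      have hy' : earlierNeighbors c H y (c s(x, y)) = earlierNeighbors c' H' y (c' s(x, y)) := by
        ext z
        simp only [earlierNeighbors, Set.mem_ofPred_eq]
        by_cases hz : G.Adj y z
        · have h1 : c s(y, z) = c' s(y, z) := by
            rw [Sym2.eq_swap]; exact hc z y hy hz.symm
          rw [← h1, ← hcc]
          refine and_congr_left fun h2 => ?_
          have h3 := ih s(y, z) (precedes_right hG hz h2) z y Sym2.eq_swap hy
          rwa [H.adj_comm, H'.adj_comm] at h3
        · exact iff_of_false (fun h => hz (le_of_step_eq hH h.1))
            (fun h => hz (le_of_step_eq hH' h.1))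
      rw [hy']
      refine and_congr_left fun _ => ?_
      by_cases hx : x ∈ W
      · exact iff_of_true (hW x hx y hy hG) (hW' x hx y hy hG)
      · have hx' : earlierNeighbors c H x (c s(x, y)) =
            earlierNeighbors c' H' x (c' s(x, y)) := by
          ext z
          simp only [earlierNeighbors, Set.mem_ofPred_eq]
          by_cases hz : G.Adj x z
          · have h1 : c s(x, z) = c' s(x, z) := by
              rw [Sym2.eq_swap]; exact hc z x hx hz.symm
            rw [← h1, ← hcc]
            refine and_congr_left fun h2 => ?_
            have h3 := ih s(x, z) (precedes_left hG hz h2) z x Sym2.eq_swap hx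
            rwa [H.adj_comm, H'.adj_comm] at h3
          · exact iff_of_false (fun h => hz (le_of_step_eq hH h.1))
              (fun h => hz (le_of_step_eq hH' h.1))
        rw [hx']
  exact key _ x y rfl hy

theorem eq_of_step_eq {c : Sym2 V → unitInterval} {H H' : SimpleGraph V}
    (hwf : WellFounded (Precedes G c)) (hH : step G k c H = H) (hH' : step G k c H' = H') :
    H = H' := by
  ext x y
  exact adj_iff_adj_of_attached (W := ∅) hwf hH hH' (fun _ _ _ _ => rfl) (by simp) (by simp)
    (Set.notMem_empty y)

/-- The graph of the edges that are eventually kept when `step` is iterated. -/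
def limitGraph (G : SimpleGraph V) (k : V → ℕ) (c : Sym2 V → unitInterval) : SimpleGraph V where
  Adj x y := ∀ᶠ n in atTop, ((step G k c)^[n] ⊥).Adj x y
  symm := ⟨fun _ _ h => h.mono fun _ h => h.symm⟩
  loopless := ⟨fun x h => by
    obtain ⟨n, h⟩ := h.exists
    exact h.ne rfl⟩

lemma iterate_step_le (c : Sym2 V → unitInterval) (n : ℕ) : (step G k c)^[n] ⊥ ≤ G := by
  cases n with
  | zero => exact bot_le
  | succ n =>
    rw [Function.iterate_succ_apply']
    exact step_le _ _

lemma limitGraph_le (c : Sym2 V → unitInterval) : limitGraph G k c ≤ G := by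
  intro x y h
  obtain ⟨n, h⟩ := Eventually.exists h
  exact iterate_step_le c n h

/-- Local finiteness turns eventual agreement edge by edge into agreement of the whole
neighbourhood. -/
lemma eventually_earlierNeighbors_eq {c : Sym2 V → unitInterval}
    (hfin : ∀ x, (G.neighborSet x).Finite) {x : V} {s : unitInterval}
    (h : ∀ z, G.Adj x z → c s(x, z) < s →
      ∀ᶠ n in atTop, (((step G k c)^[n] ⊥).Adj x z ↔ (limitGraph G k c).Adj x z)) :
    ∀ᶠ n in atTop, earlierNeighbors c ((step G k c)^[n] ⊥) x s =
      earlierNeighbors c (limitGraph G k c) x s := by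
  have h1 : ∀ z ∈ G.neighborSet x, ∀ᶠ n in atTop,
      (c s(x, z) < s → (((step G k c)^[n] ⊥).Adj x z ↔ (limitGraph G k c).Adj x z)) := by
    intro z hz
    by_cases hs : c s(x, z) < s
    · exact (h z hz hs).mono fun _ h _ => h
    · exact Eventually.of_forall fun _ h => absurd h hs
  filter_upwards [(eventually_all_finite (hfin x)).2 h1] with n hn
  ext z
  by_cases hz : G.Adj x z
  · exact and_congr_left fun hs => hn z hz hs
  · exact iff_of_false (fun h => hz (iterate_step_le c n h.1)) (fun h => hz (limitGraph_le c h.1))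

lemma eventually_adj_iff_limitGraph {c : Sym2 V → unitInterval}
    (hwf : WellFounded (Precedes G c)) (hfin : ∀ x, (G.neighborSet x).Finite) (x y : V) :
    (∀ᶠ n in atTop, (((step G k c)^[n] ⊥).Adj x y ↔ (limitGraph G k c).Adj x y)) ∧
      ((step G k c (limitGraph G k c)).Adj x y ↔ (limitGraph G k c).Adj x y) := by
  have key : ∀ e : Sym2 V, ∀ x y, e = s(x, y) →
      (∀ᶠ n in atTop, (((step G k c)^[n] ⊥).Adj x y ↔ (limitGraph G k c).Adj x y)) ∧
      ((step G k c (limitGraph G k c)).Adj x y ↔ (limitGraph G k c).Adj x y) := by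
    intro e
    induction e using hwf.induction with
    | _ e ih =>
      rintro x y rfl
      have hev : ∀ᶠ n in atTop, (((step G k c)^[n] ⊥).Adj x y ↔
          (step G k c (limitGraph G k c)).Adj x y) := by
        by_cases hG : G.Adj x y
        · have h1 := eventually_earlierNeighbors_eq (k := k) hfin fun z hz hs =>
            (ih _ (precedes_left hG hz hs) x z rfl).1
          have h2 := eventually_earlierNeighbors_eq (k := k) hfin fun z hz hs =>
            (ih _ (precedes_right hG hz hs) y z rfl).1
          suffices h : ∀ᶠ n in atTop, (((step G k c)^[n + 1] ⊥).Adj x y ↔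
              (step G k c (limitGraph G k c)).Adj x y) from by
            rwa [← map_add_atTop_eq_nat 1, eventually_map]
          filter_upwards [h1, h2] with n h1 h2
          rw [Function.iterate_succ_apply']
          simp only [step, h1, h2]
        · exact Eventually.of_forall fun n => iff_of_false (fun h => hG (iterate_step_le c n h))
            (fun h => hG h.1)
      -- Adjacency in `limitGraph` is by definition an eventual statement, and the iterates
      -- eventually agree with a constant proposition.
      have hlim : (step G k c (limitGraph G k c)).Adj x y ↔ (limitGraph G k c).Adj x y :=
        eventually_const.symm.trans (eventually_congr (hev.mono fun _ h => h.symm))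
      exact ⟨hev.mono fun _ h => h.trans hlim, hlim⟩
  exact key _ x y rfl

/-- Existence. `step` is not monotone, so convergence of the iterates rests on well-foundedness. The
explicit limit also makes the fixed point measurable in the clocks. -/
theorem step_limitGraph {c : Sym2 V → unitInterval}
    (hwf : WellFounded (Precedes G c)) (hfin : ∀ x, (G.neighborSet x).Finite) :
    step G k c (limitGraph G k c) = limitGraph G k c := by
  ext x y
  exact (eventually_adj_iff_limitGraph hwf hfin x y).2

theorem existsUnique_isTemporalConfiguration {U : G.edgeSet → unitInterval}
    (hwf : WellFounded (Precedes G (extendClock U))) (hfin : ∀ x, (G.neighborSet x).Finite) :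
    ∃! ω, IsTemporalConfiguration G k U ω := by
  refine ⟨openBefore (extendClock U) (limitGraph G k (extendClock U)),
    (isTemporalConfiguration_iff U _).2 ⟨_, step_limitGraph hwf hfin, rfl⟩, fun ω hω => ?_⟩
  obtain ⟨H, hH, rfl⟩ := (isTemporalConfiguration_iff U _).1 hω
  rw [eq_of_step_eq hwf hH (step_limitGraph hwf hfin)]

/-- Reduces all times to one graph. Equality can fail even at time `1`, since edges with clock `1`
are never open. -/
theorem temporalConfiguration_le_limitGraph {U : G.edgeSet → unitInterval}
    (hwf : WellFounded (Precedes G (extendClock U))) (hfin : ∀ x, (G.neighborSet x).Finite)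
    (t : unitInterval) : temporalConfiguration G k U t ≤ limitGraph G k (extendClock U) := by
  have h := existsUnique_isTemporalConfiguration (k := k) hwf hfin
  obtain ⟨H, hH, hω⟩ := (isTemporalConfiguration_iff U _).1 h.choose_spec.1
  rw [temporalConfiguration, dif_pos h, hω, eq_of_step_eq hwf hH (step_limitGraph hwf hfin)]
  exact fun _ _ h => h.1

end Deterministic

/-! ### No infinite chains of decreasing clocks. -/

section WellFounded

variable {E : Type*}

open Classical in
/-- The sequences of `n + 1` elements that start at `e` and go from an element to one of its
neighbours. -/
noncomputable def chains (nbr : E → Finset E) : ℕ → E → Finset (List E)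
  | 0, e => {[e]}
  | n + 1, e => (nbr e).biUnion fun e' => (chains nbr n e').image (e :: ·)

lemma card_chains_le {nbr : E → Finset E} {D : ℕ} (hD : ∀ e, (nbr e).card ≤ D) (n : ℕ) (e : E) :
    (chains nbr n e).card ≤ D ^ n := by
  classical
  induction n generalizing e with
  | zero => simp [chains]
  | succ n ih =>
    rw [chains]
    calc _ ≤ (nbr e).card * D ^ n :=
          Finset.card_biUnion_le_card_mul _ _ _ fun e' _ => Finset.card_image_le.trans (ih e')
      _ ≤ D ^ (n + 1) := by
          rw [pow_succ, mul_comm]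
          exact Nat.mul_le_mul_left _ (hD e)

lemma map_range_mem_chains {nbr : E → Finset E} (n : ℕ) (g : ℕ → E)
    (hg : ∀ i, g (i + 1) ∈ nbr (g i)) : (List.range (n + 1)).map g ∈ chains nbr n (g 0) := by
  classical
  induction n generalizing g with
  | zero => simp [chains]
  | succ n ih =>
    rw [chains, Finset.mem_biUnion]
    refine ⟨g 1, hg 0, Finset.mem_image.2 ⟨_, ih (fun i => g (i + 1)) fun i => hg (i + 1), ?_⟩⟩
    rw [List.range_succ_eq_map (n := n + 1)]
    simp

lemma volume_floor_eq_le {K : ℕ} (hK : 0 < K) (j : ℕ) :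
    (volume : Measure unitInterval) {s | ⌊(K : ℝ) * s⌋₊ = j} ≤ (K : ENNReal)⁻¹ := by
  have hK' : (0 : ℝ) < K := by exact_mod_cast hK
  rw [unitInterval.volume_apply]
  calc _ ≤ volume (Set.Ico ((j : ℝ) / K) ((j + 1) / K)) := by
        refine measure_mono ?_
        rintro _ ⟨s, hs, rfl⟩
        have h0 : 0 ≤ (K : ℝ) * s := mul_nonneg hK'.le s.2.1
        have := (Nat.floor_eq_iff h0).1 hs
        rw [Set.mem_Ico, div_le_iff₀ hK', lt_div_iff₀ hK', mul_comm]
        exact this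
    _ = (K : ENNReal)⁻¹ := by
        rw [Real.volume_Ico, ← sub_div, add_sub_cancel_left, one_div,
          ENNReal.ofReal_inv_of_pos hK', ENNReal.ofReal_natCast]

lemma measurableSet_floor_eq (K j : ℕ) :
    MeasurableSet {s : unitInterval | ⌊(K : ℝ) * s⌋₊ = j} := by
  have h : Measurable fun s : unitInterval => ⌊(K : ℝ) * s⌋₊ := by fun_prop
  exact h (measurableSet_singleton j)

/-- Union bound over at most `D ^ n` chains; the clocks along a chain without repetition are
independent. -/
lemma measure_exists_chain_le {nbr : E → Finset E} {D : ℕ} (hD : ∀ e, (nbr e).card ≤ D)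
    {J : Set unitInterval} (hJ : MeasurableSet J) (n : ℕ) (e : E) :
    Measure.infinitePi (fun _ : E => (volume : Measure unitInterval))
      {U | ∃ l ∈ chains nbr n e, l.Nodup ∧ l.length = n + 1 ∧ ∀ e' ∈ l, U e' ∈ J} ≤
      D ^ n * volume J ^ (n + 1) := by
  classical
  set μ := Measure.infinitePi (fun _ : E => (volume : Measure unitInterval))
  have hl : ∀ l ∈ (chains nbr n e).filter (fun l => l.Nodup ∧ l.length = n + 1),
      μ (Set.pi (l.toFinset : Set E) fun _ => J) ≤ volume J ^ (n + 1) := by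
    intro l hl
    obtain ⟨-, hl, hn⟩ := Finset.mem_filter.1 hl
    rw [Measure.infinitePi_pi _ fun _ _ => hJ, Finset.prod_const,
      List.toFinset_card_of_nodup hl, hn]
  calc _ ≤ μ (⋃ l ∈ (chains nbr n e).filter (fun l => l.Nodup ∧ l.length = n + 1),
        Set.pi (l.toFinset : Set E) fun _ => J) := by
        refine measure_mono ?_
        rintro U ⟨l, hl, h1, h2, h3⟩
        simp only [Set.mem_iUnion]
        exact ⟨l, Finset.mem_filter.2 ⟨hl, h1, h2⟩, fun e' he' => h3 e' (by simpa using he')⟩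
    _ ≤ _ := measure_biUnion_finset_le _ _
    _ ≤ ((chains nbr n e).filter (fun l => l.Nodup ∧ l.length = n + 1)).card •
          volume J ^ (n + 1) := Finset.sum_le_card_nsmul _ _ _ hl
    _ ≤ D ^ n * volume J ^ (n + 1) := by
        rw [nsmul_eq_mul]
        gcongr
        exact_mod_cast (Finset.card_filter_le _ _).trans (card_chains_le hD n e)

/-- If every element has a bounded number of neighbours, then almost surely there is no infinite
sequence of successive neighbours with decreasing clocks. -/
theorem ae_wellFounded_lt [Countable E] {R : E → E → Prop} {D : ℕ}
    (hR : ∀ e, {e' | R e' e}.encard ≤ D) :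
    ∀ᵐ U ∂(Measure.infinitePi fun _ : E => (volume : Measure unitInterval)),
      WellFounded fun e' e => R e' e ∧ U e' < U e := by
  classical
  have hfin : ∀ e, {e' | R e' e}.Finite := fun e => Set.finite_of_encard_le_coe (hR e)
  set nbr : E → Finset E := fun e => (hfin e).toFinset with hnbr
  have hD : ∀ e, (nbr e).card ≤ D := by
    intro e
    have h := hR e
    rw [← (hfin e).coe_toFinset, Set.encard_coe_eq_coe_finsetCard] at h
    exact_mod_cast h
  -- Windows of length `1 / K` make the union bound decay, as `D / K ≤ 1 / 2`; the `+ 1` keeps `K`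
  -- positive when `D = 0`.
  set K := 2 * D + 1 with hK
  have hK0 : 0 < K := by omega
  have hnull : ∀ e : E, ∀ j : ℕ,
      ∀ᵐ U ∂(Measure.infinitePi fun _ : E => (volume : Measure unitInterval)),
      ¬ ∀ n, ∃ l ∈ chains nbr n e, l.Nodup ∧ l.length = n + 1 ∧
        ∀ e' ∈ l, U e' ∈ {s : unitInterval | ⌊(K : ℝ) * s⌋₊ = j} := by
    intro e j
    rw [ae_iff]
    simp only [not_not]
    refine le_antisymm (ge_of_tendsto' (x := atTop)
      (ENNReal.tendsto_pow_atTop_nhds_zero_of_lt_one (r := (2 : ENNReal)⁻¹) (by simp))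
      fun n => ?_) zero_le
    refine le_trans (measure_mono ?_)
      ((measure_exists_chain_le hD (measurableSet_floor_eq K j) n e).trans ?_)
    · exact fun U hU => hU n
    have hle : (D : ENNReal) * (K : ENNReal)⁻¹ ≤ 2⁻¹ := by
      rw [← div_eq_mul_inv]
      refine ENNReal.div_le_of_le_mul ?_
      rw [mul_comm, ← div_eq_mul_inv, ENNReal.le_div_iff_mul_le (by simp) (by simp)]
      exact_mod_cast (by omega : D * 2 ≤ K)
    have h1 : (K : ENNReal)⁻¹ ≤ 1 := by
      rw [ENNReal.inv_le_one]
      exact_mod_cast hK0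
    calc (D : ENNReal) ^ n * volume {s : unitInterval | ⌊(K : ℝ) * s⌋₊ = j} ^ (n + 1)
        ≤ (D : ENNReal) ^ n * ((K : ENNReal)⁻¹) ^ (n + 1) := by
          gcongr
          exact volume_floor_eq_le hK0 j
      _ = ((D : ENNReal) * (K : ENNReal)⁻¹) ^ n * (K : ENNReal)⁻¹ := by
          rw [pow_succ, mul_pow, mul_assoc]
      _ ≤ 2⁻¹ ^ n * 1 := by gcongr
      _ = _ := mul_one _
  filter_upwards [ae_all_iff.2 fun e => ae_all_iff.2 (hnull e)] with U hU
  rw [wellFounded_iff_isEmpty_descending_chain]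
  refine ⟨fun ⟨f, hf⟩ => ?_⟩
  have hanti : StrictAnti fun n => U (f n) := strictAnti_nat_of_succ_lt fun n => (hf n).2
  set q : ℕ → ℕ := fun n => ⌊(K : ℝ) * U (f n)⌋₊ with hq
  have hqanti : Antitone q := fun m n hmn => Nat.floor_mono <|
    mul_le_mul_of_nonneg_left (hanti.antitone hmn) (Nat.cast_nonneg K)
  -- The window index is a nonincreasing sequence of naturals, hence constant from its minimum on:
  -- the tail of the chain stays in one window.
  set N := Function.argmin q with hN
  have hconst : ∀ i, q (N + i) = q N := fun i =>
    le_antisymm (hqanti (Nat.le_add_right _ _)) (Function.argmin_le q _)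
  refine hU (f N) (q N) fun n => ⟨_, map_range_mem_chains n (fun i => f (N + i)) fun i => ?_,
    ?_, by simp, ?_⟩
  · rw [hnbr, Set.Finite.mem_toFinset]
    exact (hf (N + i)).1
  · refine List.nodup_range.map fun a b hab => ?_
    have := hanti.injective (congrArg U hab)
    omega
  · simp only [List.mem_map, forall_exists_index, and_imp, forall_apply_eq_imp_iff₂]
    intro i _
    exact hconst i

end WellFounded

/-! ### Distinctness and independence of the clocks. -/

section Product

variable {E : Type*}

theorem ae_injective [Countable E] :
    ∀ᵐ U ∂(Measure.infinitePi fun _ : E => (volume : Measure unitInterval)),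
      Function.Injective U := by
  have h : ∀ i j : E, i ≠ j →
      ∀ᵐ U ∂(Measure.infinitePi fun _ : E => (volume : Measure unitInterval)), U i ≠ U j := by
    intro i j hij
    have h1 : ∀ᵐ p ∂((volume : Measure unitInterval).prod volume), p.1 ≠ p.2 := by
      have hm : MeasurableSet {p : unitInterval × unitInterval | p.1 ≠ p.2} :=
        (measurableSet_eq_fun measurable_fst measurable_snd).compl
      rw [Measure.ae_prod_iff_ae_ae hm]
      exact Eventually.of_forall fun x => (Measure.ae_ne volume x).mono fun _ h => h.symm
    rw [← Measure.infinitePi_map_eval_prod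
      (P := fun _ : E => (volume : Measure unitInterval)) hij] at h1
    exact ae_of_ae_map (f := fun U : E → unitInterval => (U i, U j)) (by fun_prop) h1
  have h2 : ∀ᵐ U ∂(Measure.infinitePi fun _ : E => (volume : Measure unitInterval)),
      ∀ i j : E, i ≠ j → U i ≠ U j := by
    simp only [ae_all_iff]
    exact h
  filter_upwards [h2] with U hU i j hij
  by_contra hne
  exact hU i j hne hij

open Classical in
/-- The clocks `U`, with those in `F` replaced by the maximal value `1`. -/
noncomputable def raise (F : Set E) (U : E → unitInterval) (e : E) : unitInterval :=
  if e ∈ F then 1 else U e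

lemma measurable_raise (F : Set E) : Measurable (raise F) := by
  refine measurable_pi_iff.2 fun e => ?_
  by_cases he : e ∈ F
  · simp only [raise, he, if_true]
    exact measurable_const
  · simp only [raise, he, if_false]
    exact measurable_pi_apply e

/-- An event that depends on the clocks off `F` is independent of a box over `F`. -/
theorem measure_raise_inter_pi (F : Finset E) {M : Set (E → unitInterval)} (hM : MeasurableSet M)
    {t : E → Set unitInterval} (ht : ∀ e, MeasurableSet (t e)) :
    Measure.infinitePi (fun _ : E => (volume : Measure unitInterval))
      (raise (F : Set E) ⁻¹' M ∩ Set.pi (F : Set E) t) =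
    Measure.infinitePi (fun _ : E => (volume : Measure unitInterval)) (raise (F : Set E) ⁻¹' M) *
      ∏ e ∈ F, volume (t e) := by
  have h := ProbabilityTheory.indep_iSup_of_disjoint
    (fun e => (measurable_pi_apply (X := fun _ : E => unitInterval) e).comap_le)
    ((ProbabilityTheory.iIndepFun_iff_iIndep _ _ _).1 (ProbabilityTheory.iIndepFun_infinitePi
      (P := fun _ : E => (volume : Measure unitInterval)) (X := fun _ s => s)
      fun _ => measurable_id)) (S := (F : Set E)ᶜ) (T := F) disjoint_compl_left
  rw [ProbabilityTheory.Indep_iff] at h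
  rw [h _ _ ?_ ?_, Measure.infinitePi_pi _ fun e _ => ht e]
  -- `raise F` reads only the coordinates off `F`, so it is measurable for the sigma-algebra that
  -- they generate.
  · have : Measurable[⨆ e ∈ (F : Set E)ᶜ, MeasurableSpace.comap
        (fun U : E → unitInterval => U e) inferInstance] (raise (F : Set E)) := by
      refine (@measurable_pi_iff _ _ _ (_) _ _).2 fun e => ?_
      by_cases he : e ∈ (F : Set E)
      · simp only [raise, he, if_true]
        exact @measurable_const _ _ _ (_) _
      · simp only [raise, he, if_false]
        exact Measurable.mono (comap_measurable _)
          (le_iSup₂_of_le (f := fun e (_ : e ∈ (F : Set E)ᶜ) => MeasurableSpace.comap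
            (fun U : E → unitInterval => U e) inferInstance) e he le_rfl) le_rfl
    exact this hM
  · rw [Set.pi_def]
    refine MeasurableSet.biInter F.countable_toSet fun e he => ?_
    refine (le_iSup₂_of_le (f := fun e (_ : e ∈ (F : Set E)) => MeasurableSpace.comap
      (fun U : E → unitInterval => U e) inferInstance) e he le_rfl) _ ?_
    exact ⟨t e, ht e, rfl⟩

end Product

/-! ### Random clocks on graphs of bounded degree, measurability, and the degree bound. -/

section BoundedDegree

variable {V : Type*} {G : SimpleGraph V} {k : V → ℕ}

theorem ae_wellFounded_precedes [Countable V] {D : ℕ}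
    (hD : ∀ x, (G.neighborSet x).encard ≤ D) :
    ∀ᵐ U ∂(clockMeasure G), WellFounded (Precedes G (extendClock U)) := by
  have hR : ∀ e : G.edgeSet, {e' : G.edgeSet | ∃ x ∈ e.1, x ∈ e'.1}.encard ≤ (2 * D : ℕ) := by
    rintro ⟨e, he⟩
    induction e using Sym2.ind with
    | _ a b =>
      rw [← Function.Injective.encard_image Subtype.val_injective]
      calc _ ≤ ((fun z => s(a, z)) '' G.neighborSet a ∪
            (fun z => s(b, z)) '' G.neighborSet b).encard := by
            refine Set.encard_le_encard ?_
            rintro _ ⟨⟨e', he'⟩, ⟨x, hx, hx'⟩, rfl⟩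
            obtain ⟨z, rfl⟩ := hx'
            rcases Sym2.mem_iff.1 hx with rfl | rfl
            · exact Or.inl ⟨z, he', rfl⟩
            · exact Or.inr ⟨z, he', rfl⟩
        _ ≤ _ := Set.encard_union_le _ _
        _ ≤ D + D := add_le_add ((Set.encard_image_le _ _).trans (hD a))
            ((Set.encard_image_le _ _).trans (hD b))
        _ = (2 * D : ℕ) := by push_cast; ring
  filter_upwards [ae_wellFounded_lt hR] with U hU
  have key : ∀ e : G.edgeSet, Acc (Precedes G (extendClock U)) e := by
    intro e
    induction e using hU.induction with
    | _ e ih =>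
      refine Acc.intro _ fun e' h => ih ⟨e', h.1⟩ ⟨h.2.2.1, ?_⟩
      have h2 := h.2.2.2
      rw [extendClock_of_mem U h.1] at h2
      exact h2.trans_eq (extendClock_of_mem U h.2.1)
  exact ⟨fun e => Acc.intro _ fun e' h => key ⟨e', h.1⟩⟩

lemma measurable_extendClock (e : Sym2 V) :
    Measurable fun U : G.edgeSet → unitInterval => extendClock U e := by
  by_cases h : e ∈ G.edgeSet
  · simp only [extendClock_of_mem _ h]
    exact measurable_pi_apply _
  · simp only [extendClock, h, dif_neg, not_false_iff]
    exact measurable_const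

/-- Rewrites the degree rule with a quantifier over finite sets, which is countable when `V` is;
used for measurability. -/
lemma encard_lt_iff_forall_finset (A : Set V) (n : ℕ) :
    A.encard < n ↔ ¬ ∃ T : Finset V, T.card = n ∧ ∀ z ∈ T, z ∈ A := by
  rw [← not_le, not_iff_not]
  constructor
  · intro h
    obtain ⟨t, ht, hn⟩ := Set.exists_subset_encard_eq h
    have hf : t.Finite := Set.finite_of_encard_eq_coe hn
    refine ⟨hf.toFinset, ?_, fun z hz => ht (by simpa using hz)⟩
    rw [← hf.coe_toFinset, Set.encard_coe_eq_coe_finsetCard] at hn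
    exact_mod_cast hn
  · rintro ⟨T, rfl, hT⟩
    rw [← Set.encard_coe_eq_coe_finsetCard]
    exact Set.encard_le_encard hT

lemma measurable_encard_earlierNeighbors_lt [Countable V]
    {H : (G.edgeSet → unitInterval) → SimpleGraph V}
    (hH : ∀ x y, Measurable fun U => (H U).Adj x y) (x : V) (e : Sym2 V) (n : ℕ) :
    Measurable fun U =>
      (earlierNeighbors (extendClock U) (H U) x (extendClock U e)).encard < n := by
  simp only [encard_lt_iff_forall_finset]
  refine (Measurable.exists fun T => Measurable.and measurable_const
    (Measurable.forall fun z => Measurable.imp measurable_const ?_)).not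
  refine (hH x z).and ?_
  exact measurableSet_setOfPred.1
    (measurableSet_lt (measurable_extendClock s(x, z)) (measurable_extendClock e))

theorem measurable_limitGraph_adj [Countable V] (x y : V) :
    Measurable fun U : G.edgeSet → unitInterval => (limitGraph G k (extendClock U)).Adj x y := by
  have h : ∀ n x y, Measurable fun U : G.edgeSet → unitInterval =>
      ((step G k (extendClock U))^[n] ⊥).Adj x y := by
    intro n
    induction n with
    | zero => exact fun _ _ => measurable_const
    | succ n ih =>
      intro x y
      simp only [Function.iterate_succ_apply']
      exact measurable_const.and ((measurable_encard_earlierNeighbors_lt ih x s(x, y) _).and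
        (measurable_encard_earlierNeighbors_lt ih y s(x, y) _))
  simp only [limitGraph, eventually_atTop]
  exact Measurable.exists fun N => Measurable.forall fun n => measurable_const.imp (h n x y)

/-- With distinct clocks, at most two edges open at a vertex with degree bound `2`. -/
theorem eq_or_eq_or_eq_of_step_eq {c : Sym2 V → unitInterval} {H : SimpleGraph V}
    (hH : step G k c H = H) (hc : Set.InjOn c G.edgeSet) {p x y z : V} (hp : k p = 2)
    (hx : H.Adj p x) (hy : H.Adj p y) (hz : H.Adj p z) : x = y ∨ x = z ∨ y = z := by
  -- The last of three open edges at `p` would have found two open ones. Distinct clocks are needed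
  -- for a last one to exist.
  have key : ∀ x y z, H.Adj p x → H.Adj p y → H.Adj p z → c s(p, x) < c s(p, z) →
      c s(p, y) < c s(p, z) → x ≠ y → False := by
    intro x y z hx hy hz h1 h2 hne
    have h := ((adj_iff_of_step_eq hH p z).1 hz).2.1
    rw [hp] at h
    refine absurd h (not_lt.2 ?_)
    rw [Nat.cast_ofNat, ← Set.encard_pair hne]
    refine Set.encard_le_encard ?_
    rintro w (rfl | rfl)
    exacts [⟨hx, h1⟩, ⟨hy, h2⟩]
  have hinj : ∀ x y, H.Adj p x → H.Adj p y → x ≠ y → c s(p, x) ≠ c s(p, y) := by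
    intro x y hx hy hne h
    have := hc (le_of_step_eq hH hx) (le_of_step_eq hH hy) h
    exact hne (Sym2.congr_right.1 this)
  by_contra! hne
  rcases lt_or_gt_of_ne (hinj x y hx hy hne.1) with h1 | h1
  · rcases lt_or_gt_of_ne (hinj y z hy hz hne.2.2) with h2 | h2
    · exact key x y z hx hy hz (h1.trans h2) h2 hne.1
    · exact key x z y hx hz hy h1 h2 hne.2.1
  · rcases lt_or_gt_of_ne (hinj x z hx hz hne.2.1) with h2 | h2
    · exact key x y z hx hy hz h2 (h1.trans h2) hne.1
    · exact key y z x hy hz hx h1 h2 hne.2.2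

end BoundedDegree

/-! ### Open paths from the root of the tree and their ends. -/

section Tree

variable {d : ℕ}

lemma adj_concat (x : List (Fin d)) (a : Fin d) : (regularTree d).Adj x (x ++ [a]) :=
  Or.inl ⟨a, rfl⟩

lemma encard_neighborSet_regularTree_le (x : List (Fin d)) :
    ((regularTree d).neighborSet x).encard ≤ (d + 1 : ℕ) := by
  calc _ ≤ (insert x.dropLast (Set.range fun a : Fin d => x ++ [a])).encard := by
        refine Set.encard_le_encard ?_
        rintro y (⟨a, rfl⟩ | ⟨a, rfl⟩)
        · exact Or.inr ⟨a, rfl⟩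
        · exact Or.inl (by simp)
    _ ≤ (Set.range fun a : Fin d => x ++ [a]).encard + 1 := Set.encard_insert_le _ _
    _ ≤ (d + 1 : ℕ) := by
        push_cast
        gcongr
        rw [← Set.image_univ]
        refine (Set.encard_image_le _ _).trans ?_
        simp

lemma finite_neighborSet_regularTree (x : List (Fin d)) :
    ((regularTree d).neighborSet x).Finite :=
  Set.finite_of_encard_le_coe (encard_neighborSet_regularTree_le x)

/-- The edge from `x` to its child `x · a`. -/
def childEdge (x : List (Fin d)) (a : Fin d) : (regularTree d).edgeSet :=
  ⟨s(x, x ++ [a]), adj_concat x a⟩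

lemma childEdge_inj {x y : List (Fin d)} {a b : Fin d} (h : childEdge x a = childEdge y b) :
    x = y ∧ a = b := by
  rcases Sym2.eq_iff.1 (congrArg Subtype.val h) with ⟨rfl, h⟩ | ⟨rfl, h⟩
  · simpa using h
  · have := congrArg List.length h
    simp at this

lemma extendClock_childEdge (U : (regularTree d).edgeSet → unitInterval) (x : List (Fin d))
    (a : Fin d) : extendClock U s(x, x ++ [a]) = U (childEdge x a) :=
  extendClock_of_mem U (adj_concat x a)

/-- All edges on the path from the root to `v` are in `H`. -/
def RootPath (H : SimpleGraph (List (Fin d))) (v : List (Fin d)) : Prop :=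
  ∀ x a, x ++ [a] <+: v → H.Adj x (x ++ [a])

/-- Along a walk from the root, a step down adds one open edge to the root path and a step up
shortens it. -/
lemma rootPath_of_reachable {H : SimpleGraph (List (Fin d))} (hH : H ≤ regularTree d)
    {v : List (Fin d)} (h : H.Reachable [] v) : RootPath H v := by
  rw [SimpleGraph.reachable_iff_reflTransGen] at h
  induction h with
  | refl => intro x a h; simp at h
  | @tail y z _ hyz ih =>
    rcases hH hyz with ⟨b, rfl⟩ | ⟨b, rfl⟩
    · intro x a h
      rcases List.prefix_concat_iff.1 h with h | h
      · obtain ⟨rfl, hab⟩ := List.append_inj' h rfl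
        obtain rfl : a = b := by simpa using hab
        exact hyz
      · exact ih x a h
    · exact fun x a h => ih x a (h.trans (List.prefix_append _ _))

/-- `v` is the last vertex on an open path that starts at the root. -/
def IsRootLeaf (H : SimpleGraph (List (Fin d))) (v : List (Fin d)) : Prop :=
  RootPath H v ∧ ∀ a, ¬ H.Adj v (v ++ [a])

/-- Beyond a non-root vertex `p` two root paths cannot separate: the edge to the parent is open, so
at most one child edge is. -/
lemma eq_of_isRootLeaf_append {c : Sym2 (List (Fin d)) → unitInterval}
    {H : SimpleGraph (List (Fin d))} (hH : step (regularTree d) (fun _ => 2) c H = H)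
    (hc : Set.InjOn c (regularTree d).edgeSet) {p v w : List (Fin d)} (hp : p ≠ [])
    (hv : IsRootLeaf H (p ++ v)) (hw : IsRootLeaf H (p ++ w)) : v = w := by
  induction v generalizing p w with
  | nil =>
    cases w with
    | nil => rfl
    | cons b w =>
      rw [List.append_nil] at hv
      exact absurd (hw.1 p b ⟨w, by simp⟩) (hv.2 b)
  | cons a v ih =>
    cases w with
    | nil =>
      rw [List.append_nil] at hw
      exact absurd (hv.1 p a ⟨v, by simp⟩) (hw.2 a)
    | cons b w =>
      obtain ⟨q, r, rfl⟩ := List.eq_nil_or_concat p |>.resolve_left hp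
      have h1 := hv.1 (q ++ [r]) a ⟨v, by simp⟩
      have h2 := hw.1 (q ++ [r]) b ⟨w, by simp⟩
      have h3 := (hv.1 q r ⟨a :: v, by simp⟩).symm
      have hab : a = b := by
        rcases eq_or_eq_or_eq_of_step_eq hH hc rfl h1 h2 h3 with h | h | h
        · simpa using h
        · have := congrArg List.length h
          simp at this
        · have := congrArg List.length h
          simp at this
      subst hab
      rw [ih (p := q ++ [r] ++ [a]) (w := w) (by simp) (by simpa using hv) (by simpa using hw)]

/-- Paths can branch at the root only, so the first letter (`none` for the root) determines the end.
-/
lemma eq_of_isRootLeaf_of_head? {c : Sym2 (List (Fin d)) → unitInterval}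
    {H : SimpleGraph (List (Fin d))} (hH : step (regularTree d) (fun _ => 2) c H = H)
    (hc : Set.InjOn c (regularTree d).edgeSet) {v w : List (Fin d)}
    (hv : IsRootLeaf H v) (hw : IsRootLeaf H w) (h : v.head? = w.head?) : v = w := by
  cases v with
  | nil =>
    cases w with
    | nil => rfl
    | cons b w => simp at h
  | cons a v =>
    cases w with
    | nil => simp at h
    | cons b w =>
      obtain rfl : a = b := by simpa using h
      rw [eq_of_isRootLeaf_append hH hc (p := [a]) (v := v) (w := w) (by simp) hv hw]

/-! ### Blocking a vertex through the three generations below it. -/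

/-- The clocks below `v` ring in such an order that all edges from `v` to its children stay closed:
each child `v · a` has used up its degree before the edge to it rings. -/
structure Blocks (c : Sym2 (List (Fin d)) → unitInterval) (v : List (Fin d))
    (s : unitInterval) : Prop where
  child (a : Fin d) : s ≤ c s(v, v ++ [a])
  early (a b : Fin d) (hb : b.val < 2) : c s(v ++ [a], v ++ [a] ++ [b]) < s
  late (a b : Fin d) (hb : ¬ b.val < 2) : s ≤ c s(v ++ [a], v ++ [a] ++ [b])
  deep (a b e : Fin d) : s ≤ c s(v ++ [a] ++ [b], v ++ [a] ++ [b] ++ [e])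

lemma Blocks.adj {c : Sym2 (List (Fin d)) → unitInterval} {v : List (Fin d)} {s : unitInterval}
    (hB : Blocks c v s) {H : SimpleGraph (List (Fin d))}
    (hH : step (regularTree d) (fun _ => 2) c H = H) (a b : Fin d) (hb : b.val < 2) :
    H.Adj (v ++ [a]) (v ++ [a] ++ [b]) := by
  rw [adj_iff_of_step_eq hH]
  refine ⟨adj_concat _ _, ?_, ?_⟩
  -- Before time `s` only the edges to children `0` and `1` ring at `v ++ [a]`, so at most one
  -- competitor precedes the edge to `b`.
  · have hz : ∀ z ∈ earlierNeighbors c H (v ++ [a]) (c s(v ++ [a], v ++ [a] ++ [b])),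
        ∃ e : Fin d, e.val < 2 ∧ e ≠ b ∧ z = v ++ [a] ++ [e] := by
      rintro z ⟨hz, hlt⟩
      rcases le_of_step_eq hH hz with ⟨e, rfl⟩ | ⟨e, he⟩
      · refine ⟨e, ?_, ?_, rfl⟩
        · by_contra h
          exact absurd (hB.late a e h) (not_le.2 (hlt.trans (hB.early a b hb)))
        · rintro rfl
          exact lt_irrefl _ hlt
      · obtain ⟨rfl, -⟩ := List.append_inj' he rfl
        rw [Sym2.eq_swap] at hlt
        exact absurd (hB.child a) (not_le.2 (hlt.trans (hB.early a b hb)))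
    have : (earlierNeighbors c H (v ++ [a]) (c s(v ++ [a], v ++ [a] ++ [b]))).encard ≤ 1 := by
      rw [Set.encard_le_one_iff]
      intro z z' h h'
      obtain ⟨e, he, hne, rfl⟩ := hz z h
      obtain ⟨e', he', hne', rfl⟩ := hz z' h'
      rw [Ne, Fin.ext_iff] at hne hne'
      rw [show e = e' from Fin.ext (by omega)]
    exact this.trans_lt (by norm_num)
  · have : earlierNeighbors c H (v ++ [a] ++ [b]) (c s(v ++ [a], v ++ [a] ++ [b])) = ∅ := by
      refine Set.eq_empty_of_forall_notMem ?_
      rintro z ⟨hz, hlt⟩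
      rcases le_of_step_eq hH hz with ⟨e, rfl⟩ | ⟨e, he⟩
      · exact absurd (hB.deep a b e) (not_le.2 (hlt.trans (hB.early a b hb)))
      · obtain ⟨rfl, -⟩ := List.append_inj' he rfl
        rw [Sym2.eq_swap] at hlt
        exact lt_irrefl _ hlt
    rw [this]
    norm_num

lemma Blocks.not_adj (hd : 2 ≤ d) {c : Sym2 (List (Fin d)) → unitInterval} {v : List (Fin d)}
    {s : unitInterval} (hB : Blocks c v s) {H : SimpleGraph (List (Fin d))}
    (hH : step (regularTree d) (fun _ => 2) c H = H) (a : Fin d) : ¬ H.Adj v (v ++ [a]) := by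
  intro h
  refine absurd ((adj_iff_of_step_eq hH _ _).1 h).2.2 (not_lt.2 ?_)
  have hne : v ++ [a] ++ [(⟨0, by omega⟩ : Fin d)] ≠ v ++ [a] ++ [(⟨1, by omega⟩ : Fin d)] := by
    simp
  rw [Nat.cast_ofNat, ← Set.encard_pair hne]
  refine Set.encard_le_encard ?_
  rintro w (rfl | rfl)
  · exact ⟨hB.adj hH a _ (by simp), (hB.early a _ (by simp)).trans_le (hB.child a)⟩
  · exact ⟨hB.adj hH a _ (by simp), (hB.early a _ (by simp)).trans_le (hB.child a)⟩

/-- Applied in two situations: when the child edges have clock `1`, and when no child edge opens. -/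
lemma encard_earlierNeighbors_concat_lt {c : Sym2 (List (Fin d)) → unitInterval}
    {H : SimpleGraph (List (Fin d))} (hH : H ≤ regularTree d) {y : List (Fin d)} {a : Fin d}
    (h : ∀ b, H.Adj (y ++ [a]) (y ++ [a] ++ [b]) →
      c s(y ++ [a], y) ≤ c s(y ++ [a], y ++ [a] ++ [b])) :
    (earlierNeighbors c H (y ++ [a]) (c s(y ++ [a], y))).encard < (2 : ℕ) := by
  have : earlierNeighbors c H (y ++ [a]) (c s(y ++ [a], y)) = ∅ := by
    refine Set.eq_empty_of_forall_notMem ?_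
    rintro z ⟨hz, hlt⟩
    rcases hH hz with ⟨b, rfl⟩ | ⟨b, hb⟩
    · exact absurd (h b hz) (not_le.2 hlt)
    · obtain ⟨rfl, -⟩ := List.append_inj' hb rfl
      exact lt_irrefl _ hlt
  rw [this]
  norm_num

/-- The path from the root to `v` depends on the clocks below `v` only through the rule at `v`. -/
theorem rootPath_iff_of_attached {c c' : Sym2 (List (Fin d)) → unitInterval}
    {H H' : SimpleGraph (List (Fin d))} {v : List (Fin d)}
    (hwf : WellFounded (Precedes (regularTree d) c))
    (hH : step (regularTree d) (fun _ => 2) c H = H)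
    (hH' : step (regularTree d) (fun _ => 2) c' H' = H')
    (hc : ∀ x y, ¬ v <+: y → (regularTree d).Adj x y → c s(x, y) = c' s(x, y))
    (hv : ∀ y a, v = y ++ [a] → (earlierNeighbors c H v (c s(v, y))).encard < (2 : ℕ))
    (hv' : ∀ y a, v = y ++ [a] → (earlierNeighbors c' H' v (c' s(v, y))).encard < (2 : ℕ)) :
    RootPath H v ↔ RootPath H' v := by
  -- The subtree at `v` is attached to the rest only by the edge from `v` to its parent.
  have hW : ∀ x ∈ {x | v <+: x}, ∀ y ∉ {x | v <+: x}, (regularTree d).Adj x y →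
      x = v ∧ ∃ a, v = y ++ [a] := by
    rintro x hx y hy (⟨a, rfl⟩ | ⟨a, rfl⟩)
    · exact absurd (List.IsPrefix.trans hx (List.prefix_append _ _)) hy
    · rcases List.prefix_concat_iff.1 hx with h | h
      · exact ⟨h.symm, a, h⟩
      · exact absurd h hy
  refine forall_congr' fun x => forall_congr' fun a => imp_congr_right fun hx => ?_
  rw [H.adj_comm, H'.adj_comm]
  refine adj_iff_adj_of_attached (W := {x | v <+: x}) hwf hH hH' hc ?_ ?_ ?_
  · intro x hx y hy hxy
    obtain ⟨rfl, a, ha⟩ := hW x hx y hy hxy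
    exact hv y a ha
  · intro x hx y hy hxy
    obtain ⟨rfl, a, ha⟩ := hW x hx y hy hxy
    exact hv' y a ha
  · intro h
    have h1 := List.IsPrefix.length_le h
    have h2 := hx.length_le
    simp at h2
    omega

/-! ### Decoupling the path to `v` from the clocks below `v`. -/

open Classical in
/-- The edges in the three generations below `v`. -/
noncomputable def belowEdges (v : List (Fin d)) : Finset (regularTree d).edgeSet :=
  (Finset.univ.image fun a : Fin d => childEdge v a) ∪
  (Finset.univ.image fun p : Fin d × Fin d => childEdge (v ++ [p.1]) p.2) ∪
  (Finset.univ.image fun p : Fin d × Fin d × Fin d => childEdge (v ++ [p.1] ++ [p.2.1]) p.2.2)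

lemma card_belowEdges_le (v : List (Fin d)) :
    (belowEdges v).card ≤ d + d * d + d * (d * d) := by
  classical
  refine (Finset.card_union_le _ _).trans (add_le_add ((Finset.card_union_le _ _).trans
    (add_le_add ?_ ?_)) ?_) <;>
  exact Finset.card_image_le.trans (by simp)

lemma childEdge_mem_belowEdges (v : List (Fin d)) (a : Fin d) : childEdge v a ∈ belowEdges v := by
  simp [belowEdges]

lemma childEdge_mem_belowEdges_two (v : List (Fin d)) (a b : Fin d) :
    childEdge (v ++ [a]) b ∈ belowEdges v :=
  Finset.mem_union_left _ (Finset.mem_union_right _ (Finset.mem_image_of_mem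
    (fun p : Fin d × Fin d => childEdge (v ++ [p.1]) p.2) (Finset.mem_univ (a, b))))

lemma childEdge_mem_belowEdges_three (v : List (Fin d)) (a b e : Fin d) :
    childEdge (v ++ [a] ++ [b]) e ∈ belowEdges v :=
  Finset.mem_union_right _ (Finset.mem_image_of_mem
    (fun p : Fin d × Fin d × Fin d => childEdge (v ++ [p.1] ++ [p.2.1]) p.2.2)
    (Finset.mem_univ (a, b, e)))

lemma exists_of_mem_belowEdges {v : List (Fin d)} {e : (regularTree d).edgeSet}
    (h : e ∈ belowEdges v) : ∃ x a, v <+: x ∧ e = childEdge x a := by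
  simp only [belowEdges, Finset.mem_union, Finset.mem_image, Finset.mem_univ, true_and] at h
  rcases h with (⟨a, rfl⟩ | ⟨p, rfl⟩) | ⟨p, rfl⟩
  · exact ⟨v, a, List.prefix_rfl, rfl⟩
  · exact ⟨_, _, List.prefix_append _ _, rfl⟩
  · exact ⟨_, _, by simp, rfl⟩

lemma extendClock_raise_belowEdges (U : (regularTree d).edgeSet → unitInterval)
    {v x y : List (Fin d)} (hy : ¬ v <+: y) (hxy : (regularTree d).Adj x y) :
    extendClock U s(x, y) = extendClock (raise (belowEdges v : Set _) U) s(x, y) := by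
  have h : s(x, y) ∈ (regularTree d).edgeSet := hxy
  rw [extendClock_of_mem _ h, extendClock_of_mem _ h, raise, if_neg]
  intro hmem
  obtain ⟨z, a, hz, he⟩ := exists_of_mem_belowEdges hmem
  rcases Sym2.eq_iff.1 (congrArg Subtype.val he) with ⟨-, rfl⟩ | ⟨-, rfl⟩
  · exact hy (hz.trans (List.prefix_append _ _))
  · exact hy hz

lemma wellFounded_precedes_raise {V : Type*} {G : SimpleGraph V} (F : Set G.edgeSet)
    {U : G.edgeSet → unitInterval} (hwf : WellFounded (Precedes G (extendClock U))) :
    WellFounded (Precedes G (extendClock (raise F U))) := by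
  refine wellFounded_precedes_of_eq_or_eq_one hwf fun e => ?_
  by_cases he : e ∈ G.edgeSet
  · rw [extendClock_of_mem _ he, extendClock_of_mem _ he, raise]
    split_ifs
    · exact Or.inr rfl
    · exact Or.inl rfl
  · exact Or.inr (dif_neg he)

/-- The open edges of the model with degree bound `2` on the tree. -/
noncomputable def finalGraph (U : (regularTree d).edgeSet → unitInterval) :
    SimpleGraph (List (Fin d)) :=
  limitGraph (regularTree d) (fun _ => 2) (extendClock U)

/-- The path from the root to `v` opens, if the clocks below `v` are stopped. -/
def reachEvent (v : List (Fin d)) : Set ((regularTree d).edgeSet → unitInterval) :=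
  raise (belowEdges v : Set (regularTree d).edgeSet) ⁻¹' {U | RootPath (finalGraph U) v}

lemma measurableSet_rootPath (v : List (Fin d)) :
    MeasurableSet {U : (regularTree d).edgeSet → unitInterval | RootPath (finalGraph U) v} := by
  refine measurableSet_setOfPred.2 ?_
  exact Measurable.forall fun x => Measurable.forall fun a =>
    measurable_const.imp (measurable_limitGraph_adj x (x ++ [a]))

lemma rootPath_iff_mem_reachEvent {U : (regularTree d).edgeSet → unitInterval}
    (hwf : WellFounded (Precedes (regularTree d) (extendClock U))) {v : List (Fin d)}
    (hv : ∀ y a, v = y ++ [a] → (earlierNeighbors (extendClock U) (finalGraph U) v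
      (extendClock U s(v, y))).encard < (2 : ℕ)) :
    RootPath (finalGraph U) v ↔ U ∈ reachEvent v := by
  have hwf' := wellFounded_precedes_raise (belowEdges v : Set (regularTree d).edgeSet) hwf
  refine rootPath_iff_of_attached hwf (step_limitGraph hwf finite_neighborSet_regularTree)
    (step_limitGraph hwf' finite_neighborSet_regularTree)
    (fun x y hy hxy => extendClock_raise_belowEdges U hy hxy) hv ?_
  rintro y a rfl
  refine encard_earlierNeighbors_concat_lt (limitGraph_le _) fun b _ => ?_
  rw [extendClock_childEdge, raise, if_pos]
  · exact unitInterval.le_one'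
  · exact childEdge_mem_belowEdges _ _

/-- If the path is open, then so is the parent edge of `v`; the rule at `v` did not obstruct it, and
stopping the clocks below changes nothing. -/
lemma mem_reachEvent_of_rootPath {U : (regularTree d).edgeSet → unitInterval}
    (hwf : WellFounded (Precedes (regularTree d) (extendClock U))) {v : List (Fin d)}
    (h : RootPath (finalGraph U) v) : U ∈ reachEvent v := by
  refine (rootPath_iff_mem_reachEvent hwf ?_).1 h
  rintro y a rfl
  have hadj := (h y a List.prefix_rfl).symm
  exact ((adj_iff_of_step_eq (step_limitGraph hwf finite_neighborSet_regularTree) _ _).1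
    hadj).2.1

/-- A blocked `v` has no open child edges to obstruct its parent edge, so reaching `v` with stopped
clocks means really reaching it. -/
lemma isRootLeaf_of_blocks (hd : 2 ≤ d) {U : (regularTree d).edgeSet → unitInterval}
    (hwf : WellFounded (Precedes (regularTree d) (extendClock U))) {v : List (Fin d)}
    {s : unitInterval} (hB : Blocks (extendClock U) v s) (h : U ∈ reachEvent v) :
    IsRootLeaf (finalGraph U) v := by
  have hfix := step_limitGraph (k := fun _ => 2) hwf finite_neighborSet_regularTree
  have hleaf := hB.not_adj hd hfix
  refine ⟨(rootPath_iff_mem_reachEvent hwf ?_).2 h, hleaf⟩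
  rintro y a rfl
  exact encard_earlierNeighbors_concat_lt (limitGraph_le _) fun b hb => absurd hb (hleaf b)

open Classical in
/-- The sets in which the clocks below `v` have to lie to block `v` at time `s`. -/
noncomputable def blockingSlot (v : List (Fin d)) (s : unitInterval)
    (e : (regularTree d).edgeSet) : Set unitInterval :=
  if ∃ a b : Fin d, b.val < 2 ∧ e = childEdge (v ++ [a]) b then Set.Iio s else Set.Ici s

lemma measurableSet_blockingSlot (v : List (Fin d)) (s : unitInterval)
    (e : (regularTree d).edgeSet) : MeasurableSet (blockingSlot v s e) := by
  unfold blockingSlot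
  split_ifs
  · exact measurableSet_Iio
  · exact measurableSet_Ici

lemma blocks_of_mem_pi {U : (regularTree d).edgeSet → unitInterval} {v : List (Fin d)}
    {s : unitInterval}
    (h : U ∈ Set.pi (belowEdges v : Set (regularTree d).edgeSet) (blockingSlot v s)) :
    Blocks (extendClock U) v s where
  child a := by
    have h1 := h _ (childEdge_mem_belowEdges v a)
    rw [blockingSlot, if_neg] at h1
    · rw [extendClock_childEdge]
      exact h1
    · rintro ⟨a', b', -, he⟩
      simpa using (childEdge_inj he).1
  early a b hb := by
    have h1 := h _ (childEdge_mem_belowEdges_two v a b)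
    rw [blockingSlot, if_pos ⟨a, b, hb, rfl⟩] at h1
    rw [extendClock_childEdge]
    exact h1
  late a b hb := by
    have h1 := h _ (childEdge_mem_belowEdges_two v a b)
    rw [blockingSlot, if_neg] at h1
    · rw [extendClock_childEdge]
      exact h1
    · rintro ⟨a', b', hb', he⟩
      exact hb ((childEdge_inj he).2 ▸ hb')
  deep a b e := by
    have h1 := h _ (childEdge_mem_belowEdges_three v a b e)
    rw [blockingSlot, if_neg] at h1
    · rw [extendClock_childEdge]
      exact h1
    · rintro ⟨a', b', -, he⟩
      have := congrArg List.length (childEdge_inj he).1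
      simp at this

/-- The midpoint of the unit interval. -/
noncomputable def half : unitInterval := ⟨1 / 2, by norm_num, by norm_num⟩

lemma volume_blockingSlot_half (v : List (Fin d)) (e : (regularTree d).edgeSet) :
    volume (blockingSlot v half e) = (2 : ENNReal)⁻¹ := by
  have h2 : ENNReal.ofReal (2 : ℝ)⁻¹ = (2 : ENNReal)⁻¹ := by
    rw [ENNReal.ofReal_inv_of_pos (by norm_num), ENNReal.ofReal_ofNat]
  unfold blockingSlot half
  split_ifs
  · rw [unitInterval.volume_Iio, ← h2]
    norm_num
  · rw [unitInterval.volume_Ici, ← h2]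
    norm_num

lemma injOn_extendClock {V : Type*} {G : SimpleGraph V} {U : G.edgeSet → unitInterval}
    (hU : Function.Injective U) : Set.InjOn (extendClock U) G.edgeSet := by
  intro e he e' he' h
  rw [extendClock_of_mem U he, extendClock_of_mem U he'] at h
  exact congrArg Subtype.val (hU h)

lemma card_le_of_isRootLeaf {c : Sym2 (List (Fin d)) → unitInterval}
    {H : SimpleGraph (List (Fin d))} (hH : step (regularTree d) (fun _ => 2) c H = H)
    (hc : Set.InjOn c (regularTree d).edgeSet) {s : Finset (List (Fin d))}
    (hs : ∀ v ∈ s, IsRootLeaf H v) : s.card ≤ d + 1 := by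
  calc s.card ≤ (Finset.univ : Finset (Option (Fin d))).card :=
        Finset.card_le_card_of_injOn List.head? (fun _ _ => Finset.mem_univ _)
          fun v hv w hw h => eq_of_isRootLeaf_of_head? hH hc (hs v hv) (hs w hw) h
    _ = d + 1 := by simp

/-! ### Counting ends in expectation, and Borel–Cantelli. -/

theorem sum_measure_reachEvent_inter_le (hd : 2 ≤ d) (s : Finset (List (Fin d))) :
    ∑ v ∈ s, clockMeasure (regularTree d) (reachEvent v ∩
      Set.pi (belowEdges v : Set (regularTree d).edgeSet) (blockingSlot v half)) ≤
      (d + 1 : ℕ) := by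
  classical
  set T : List (Fin d) → Set ((regularTree d).edgeSet → unitInterval) := fun v =>
    reachEvent v ∩ Set.pi (belowEdges v : Set (regularTree d).edgeSet) (blockingSlot v half)
  have hT : ∀ v, MeasurableSet (T v) := fun v =>
    (measurable_raise _ (measurableSet_rootPath v)).inter
      (MeasurableSet.pi (Finset.countable_toSet _) fun e _ => measurableSet_blockingSlot v half e)
  have : IsProbabilityMeasure (clockMeasure (regularTree d)) := by
    unfold clockMeasure
    infer_instance
  calc _ = ∑ v ∈ s, ∫⁻ U, (T v).indicator 1 U ∂(clockMeasure (regularTree d)) := by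
        simp only [lintegral_indicator_one (hT _)]
        rfl
    _ = ∫⁻ U, ∑ v ∈ s, (T v).indicator 1 U ∂(clockMeasure (regularTree d)) :=
        (lintegral_finsetSum _ fun v _ => measurable_one.indicator (hT v)).symm
    _ ≤ ∫⁻ _, (d + 1 : ℕ) ∂(clockMeasure (regularTree d)) := by
        refine lintegral_mono_ae ?_
        filter_upwards [ae_wellFounded_precedes encard_neighborSet_regularTree_le,
          ae_injective] with U hwf hinj
        -- Each `v` with `U ∈ T v` is an end of the root's cluster.
        have hcard : (s.filter fun v => U ∈ T v).card ≤ d + 1 := card_le_of_isRootLeaf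
          (step_limitGraph hwf finite_neighborSet_regularTree) (injOn_extendClock hinj)
          fun v hv => isRootLeaf_of_blocks hd hwf (blocks_of_mem_pi (Finset.mem_filter.1 hv).2.2)
            (Finset.mem_filter.1 hv).2.1
        rw [Finset.card_filter] at hcard
        simp only [Set.indicator_apply, Pi.one_apply]
        exact_mod_cast hcard
    _ = (d + 1 : ℕ) := by simp

theorem tsum_measure_reachEvent_ne_top (hd : 2 ≤ d) :
    ∑' v : List (Fin d), clockMeasure (regularTree d) (reachEvent v) ≠ ⊤ := by
  set N := d + d * d + d * (d * d)
  have hp : (2 : ENNReal)⁻¹ ^ N ≠ 0 := pow_ne_zero _ (by simp)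
  have hle : ∀ v : List (Fin d), clockMeasure (regularTree d) (reachEvent v) * 2⁻¹ ^ N ≤
      clockMeasure (regularTree d) (reachEvent v ∩
        Set.pi (belowEdges v : Set (regularTree d).edgeSet) (blockingSlot v half)) := by
    intro v
    rw [clockMeasure, reachEvent, measure_raise_inter_pi _ (measurableSet_rootPath v)
      (measurableSet_blockingSlot v half)]
    gcongr
    simp only [volume_blockingSlot_half, Finset.prod_const]
    exact pow_le_pow_right_of_le_one' (by simp) (card_belowEdges_le v)
  intro htop
  have h : (∑' v : List (Fin d), clockMeasure (regularTree d) (reachEvent v)) * 2⁻¹ ^ N ≤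
      (d + 1 : ℕ) := by
    rw [← ENNReal.tsum_mul_right, ENNReal.tsum_eq_iSup_sum]
    exact iSup_le fun s => (Finset.sum_le_sum fun v _ => hle v).trans
      (sum_measure_reachEvent_inter_le hd s)
  rw [htop, ENNReal.top_mul hp] at h
  exact absurd h (not_le.2 (ENNReal.natCast_lt_top _))

/-- Almost surely, the root is connected to finitely many vertices only. -/
theorem ae_finite_rootPath (hd : 2 ≤ d) :
    ∀ᵐ U ∂(clockMeasure (regularTree d)), {v | RootPath (finalGraph U) v}.Finite := by
  filter_upwards [ae_finite_setOfPred_mem (tsum_measure_reachEvent_ne_top hd),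
    ae_wellFounded_precedes encard_neighborSet_regularTree_le] with U hfin hwf
  exact hfin.subset fun v hv => mem_reachEvent_of_rootPath hwf hv

end Tree

end ConstrainedDegree

theorem proposition4 (d : ℕ) (hd : 2 ≤ d) :
    (∀ᵐ U ∂(ConstrainedDegree.clockMeasure (ConstrainedDegree.regularTree d)),
      ∃! ω, ConstrainedDegree.IsTemporalConfiguration
        (ConstrainedDegree.regularTree d) (fun _ => 2) U ω) ∧
    ∀ t : unitInterval,
      ConstrainedDegree.theta (ConstrainedDegree.regularTree d) (fun _ => 2) [] t = 0 := by
  have hwf := ConstrainedDegree.ae_wellFounded_precedes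
    (ConstrainedDegree.encard_neighborSet_regularTree_le (d := d))
  refine ⟨?_, fun t => ?_⟩
  · filter_upwards [hwf] with U hU
    exact ConstrainedDegree.existsUnique_isTemporalConfiguration hU
      ConstrainedDegree.finite_neighborSet_regularTree
  -- Inclusion in a null set suffices, so measurability of the percolation event is not needed.
  · refine measure_mono_null ?_ (ae_iff.1 (hwf.and (ConstrainedDegree.ae_finite_rootPath hd)))
    rintro U hU ⟨h1, h2⟩
    have hle := ConstrainedDegree.temporalConfiguration_le_limitGraph (k := fun _ => 2) h1
      ConstrainedDegree.finite_neighborSet_regularTree t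
    exact hU (h2.subset fun v hv => ConstrainedDegree.rootPath_of_reachable
      (ConstrainedDegree.limitGraph_le _) (hv.mono hle))
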